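/- Let $G$ be a finite simple graph on $n$ vertices without isolated vertices, with vertex degrees $d_1,\dots,d_n$, largest degree $\delta_M$ and smallest degree $\delta_m\ (\neq 0)$. Let $A_{ex}(G)$ be the $n\times n$ real symmetric matrix whose $(i,j)$ entry is $\frac12\left(\frac{d_i}{d_j}+\frac{d_j}{d_i}\right)$ if the vertices $i$ and $j$ are adjacent and $0$ otherwise, let $\eta_1,\dots,\eta_n$ be its eigenvalues counted with multiplicity, and let $\varepsilon_{ex}(G)=\sum_{j=1}^n|\eta_j|$ be the extended energy of $G$. Then $$\varepsilon_{ex}(G)\le \frac n4\left(\frac{\delta_M}{\delta_m}+\frac{\delta_m}{\delta_M}\right)\left(1+\sqrt n\right),$$ and equality holds if and only if $G$ is a strongly regular graph with parameters $$\left(n,\ \frac n2+\frac{\sqrt n}2,\ \frac n4+\frac{\sqrt n}2,\ \frac n4+\frac{\sqrt n}2\right).$$ Here $G$ is strongly regular with parameters $(n,k,\lambda,\mu)$ ($k,\lambda,\mu$ nonnegative integers) if it has $n$ vertices, every vertex has degree $k$, any two adjacent vertices have exactly $\lambda$ common neighbours, and any two distinct non-adjacent vertices have exactly $\mu$ common neighbours;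 complete graphs are allowed (the last condition is then vacuous). Moreover, this bound is never weaker than the bound $\frac n8(1+\sqrt n)\left(\frac{\delta_M}{\delta_m}+\frac{\delta_m}{\delta_M}\right)^2$ of Wang et al., that is, $$\frac n4\left(\frac{\delta_M}{\delta_m}+\frac{\delta_m}{\delta_M}\right)\left(1+\sqrt n\right)\le\frac n8\left(1+\sqrt n\right)\left(\frac{\delta_M}{\delta_m}+\frac{\delta_m}{\delta_M}\right)^2 .$$ -/

import Mathlib

namespace ExtendedEnergy

/-- The extended adjacency matrix of a finite simple graph: the `(i, j)` entry is
`(d_i / d_j + d_j / d_i) / 2` if `i` and `j` are adjacent, and `0` otherwise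
(adjacent vertices have nonzero degree, so the quotients are genuine). -/
noncomputable def extAdjMatrix {V : Type*} [Fintype V] (G : SimpleGraph V)
    [DecidableRel G.Adj] : Matrix V V ℝ :=
  Matrix.of fun i j =>
    if G.Adj i j then
      ((G.degree i : ℝ) / (G.degree j : ℝ) + (G.degree j : ℝ) / (G.degree i : ℝ)) / 2
    else 0

theorem extAdjMatrix_isHermitian {V : Type*} [Fintype V] (G : SimpleGraph V)
    [DecidableRel G.Adj] : (extAdjMatrix G).IsHermitian := by
  ext i j
  simp [extAdjMatrix, Matrix.conjTranspose_apply, G.adj_comm j i, add_comm]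

/-- The extended energy of `G`: the sum of the absolute values of the eigenvalues
(with multiplicity) of the extended adjacency matrix. -/
noncomputable def extEnergy {V : Type*} [Fintype V] [DecidableEq V] (G : SimpleGraph V)
    [DecidableRel G.Adj] : ℝ :=
  ∑ i : V, |(extAdjMatrix_isHermitian G).eigenvalues i|

end ExtendedEnergy

namespace ExtendedEnergy

open Matrix Finset

/-! ### Trace bounds for symmetric involutions -/

section MatrixEnergy

variable {V : Type*} [Fintype V] [DecidableEq V] {A S : Matrix V V ℝ}

/-! The energy is tr(S·A_ex), where S is the sign of A_ex, a symmetric involution. Divide A_ex by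
`entryBound` to get A with entries in [0,1], and put B = 2A − J, with entries in [−1,1]. Then 2
tr(SA) = 1ᵀS1 + ⟨S,B⟩ ≤ n + n√n, since S is orthogonal and its Frobenius norm is √n.
`trace_mul_deficit` keeps the loss as explicit nonnegative terms.

If there is no loss, then S1 = 1, √n·S = B and A is a 0-1 matrix, so A is the adjacency matrix.
Hence B is `signMatrix`, with row sums √n and B² = nI, which are the strongly regular conditions
(`isSRGWith_iff_signMatrix`). Conversely, B/√n is then orthogonal, and tr(SA) for orthogonal S never
exceeds the energy. -/

theorem exists_involution_trace_mul_eq (hA : A.IsHermitian) :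
    ∃ S : Matrix V V ℝ, Sᵀ = S ∧ S * S = 1 ∧ (S * A).trace = ∑ i, |hA.eigenvalues i| := by
  set U : Matrix V V ℝ := (hA.eigenvectorUnitary : Matrix V V ℝ) with hU
  have hUU : star U * U = 1 := Unitary.coe_star_mul_self hA.eigenvectorUnitary
  have hUU' : U * star U = 1 := Unitary.coe_mul_star_self hA.eigenvectorUnitary
  have hspec : A = U * diagonal hA.eigenvalues * star U := by
    conv_lhs => rw [hA.spectral_theorem, Unitary.conjStarAlgAut_apply]
    rfl
  -- The sign of a zero eigenvalue is taken to be 1, so that S² = 1 even for singular A.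
  let s : V → ℝ := fun i => if 0 ≤ hA.eigenvalues i then 1 else -1
  have hs : ∀ i, s i * s i = 1 := fun i => by simp only [s]; split_ifs <;> norm_num
  have hs' : ∀ i, s i * hA.eigenvalues i = |hA.eigenvalues i| := fun i => by
    simp only [s]
    split_ifs with h
    · rw [abs_of_nonneg h, one_mul]
    · rw [abs_of_neg (not_le.1 h), neg_one_mul]
  have hconj : ∀ D E : Matrix V V ℝ,
      U * D * star U * (U * E * star U) = U * (D * E) * star U := fun D E => by
    calc _ = U * D * (star U * U) * E * star U := by simp only [Matrix.mul_assoc]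
      _ = _ := by rw [hUU, Matrix.mul_one]; simp only [Matrix.mul_assoc]
  refine ⟨U * diagonal s * star U, ?_, ?_, ?_⟩
  · rw [star_eq_conjTranspose, conjTranspose_eq_transpose_of_trivial, transpose_mul,
      transpose_mul, transpose_transpose, diagonal_transpose, Matrix.mul_assoc]
  · rw [hconj, diagonal_mul_diagonal]
    simp only [hs, diagonal_one, Matrix.mul_one, hUU']
  · conv_lhs => rw [hspec]
    rw [hconj, Matrix.trace_mul_comm, ← Matrix.mul_assoc, hUU, Matrix.one_mul,
      diagonal_mul_diagonal, trace_diagonal]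
    exact sum_congr rfl fun i _ => hs' i

/-- In an eigenbasis of A only the diagonal of the conjugated orthogonal matrix matters, and its
entries have absolute value at most 1. -/
theorem trace_mul_le_sum_abs_eigenvalues (hA : A.IsHermitian)
    (hS : S ∈ Matrix.unitaryGroup V ℝ) : (S * A).trace ≤ ∑ i, |hA.eigenvalues i| := by
  set U : Matrix V V ℝ := (hA.eigenvectorUnitary : Matrix V V ℝ) with hU
  have hspec : A = U * diagonal hA.eigenvalues * star U := by
    conv_lhs => rw [hA.spectral_theorem, Unitary.conjStarAlgAut_apply]
    rfl
  have hmem : star U * S * U ∈ Matrix.unitaryGroup V ℝ :=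
    mul_mem (mul_mem (Unitary.star_mem hA.eigenvectorUnitary.2) hS) hA.eigenvectorUnitary.2
  have htr : (S * A).trace = ∑ i, (star U * S * U) i i * hA.eigenvalues i := by
    conv_lhs => rw [hspec]
    rw [← Matrix.mul_assoc, Matrix.trace_mul_comm, ← Matrix.mul_assoc, ← Matrix.mul_assoc]
    simp [Matrix.trace, mul_diagonal]
  rw [htr]
  refine sum_le_sum fun i _ => (le_abs_self _).trans ?_
  rw [abs_mul]
  exact mul_le_of_le_one_left (abs_nonneg _) (entry_norm_bound_of_unitary hmem i i)

theorem sum_sq_eq_card_of_involution (hT : Sᵀ = S) (hS : S * S = 1) :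
    ∑ i, ∑ j, S i j ^ 2 = Fintype.card V := by
  have h : ∀ i, ∑ j, S i j ^ 2 = 1 := fun i => by
    have := congrFun (congrFun hS i) i
    rw [Matrix.mul_apply, Matrix.one_apply_eq] at this
    rw [← this]
    refine sum_congr rfl fun j _ => ?_
    rw [sq, show S j i = S i j from congrFun (congrFun hT i) j]
  simp [h]

/-- The entries of a symmetric involution sum to at most the order of the matrix; the deficit is
half the squared distance from the all-ones vector to its image. -/
theorem sum_sq_rowSum_sub_one_of_involution (hT : Sᵀ = S) (hS : S * S = 1) :
    ∑ i, (∑ j, S i j - 1) ^ 2 = 2 * (Fintype.card V - ∑ i, ∑ j, S i j) := by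
  have h : ∑ i, (∑ j, S i j) ^ 2 = Fintype.card V := by
    have h1 : (S *ᵥ 1) ⬝ᵥ (S *ᵥ 1) = (1 : V → ℝ) ⬝ᵥ 1 := by
      rw [dotProduct_mulVec, ← mulVec_transpose, hT, mulVec_mulVec, hS, one_mulVec]
    simpa [dotProduct, mulVec, sq] using h1
  simp only [sub_sq, sum_add_distrib, sum_sub_distrib, h, ← mul_sum, mul_one, one_pow, sum_const,
    card_univ, nsmul_eq_mul]
  ring

/-- Cauchy–Schwarz for ⟨S,B⟩ in exact form, so that the equality case can be read off. -/
theorem sum_sq_sqrt_card_smul_sub (hT : Sᵀ = S) (hS : S * S = 1) (B : Matrix V V ℝ) :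
    ∑ i, ∑ j, (√(Fintype.card V) * S i j - B i j) ^ 2 =
      (Fintype.card V : ℝ) ^ 2 + ∑ i, ∑ j, B i j ^ 2 -
        2 * √(Fintype.card V) * ∑ i, ∑ j, S i j * B i j := by
  have hn : √(Fintype.card V : ℝ) ^ 2 = Fintype.card V := Real.sq_sqrt (Nat.cast_nonneg _)
  have : ∀ i j, (√(Fintype.card V) * S i j - B i j) ^ 2 =
      Fintype.card V * S i j ^ 2 + B i j ^ 2 - 2 * √(Fintype.card V) * (S i j * B i j) :=
    fun i j => by linear_combination S i j ^ 2 * hn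
  simp only [this, sum_add_distrib, sum_sub_distrib, ← mul_sum,
    sum_sq_eq_card_of_involution hT hS]
  ring

/-- For a symmetric involution `S`, the deficit in the bound
`2 tr(SA) ≤ n + n√n` for matrices with entries in `[0, 1]`, as a sum of nonnegative terms. -/
theorem trace_mul_deficit (hT : Sᵀ = S) (hS : S * S = 1) (hA : Aᵀ = A) :
    4 * √(Fintype.card V) * (S * A).trace =
      2 * √(Fintype.card V) * Fintype.card V * (1 + √(Fintype.card V))
        - √(Fintype.card V) * ∑ i, (∑ j, S i j - 1) ^ 2
        - ∑ i, ∑ j, (√(Fintype.card V) * S i j - (2 * A i j - 1)) ^ 2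
        - ∑ i, ∑ j, (1 - (2 * A i j - 1) ^ 2) := by
  have hn : √(Fintype.card V : ℝ) ^ 2 = Fintype.card V := Real.sq_sqrt (Nat.cast_nonneg _)
  have htr : (S * A).trace = ∑ i, ∑ j, S i j * A i j := by
    refine sum_congr rfl fun i _ => ?_
    rw [diag_apply, Matrix.mul_apply]
    exact sum_congr rfl fun j _ => by rw [show A j i = A i j from congrFun (congrFun hA i) j]
  have h1 := sum_sq_rowSum_sub_one_of_involution hT hS
  have h2 := sum_sq_sqrt_card_smul_sub hT hS (of fun i j => 2 * A i j - 1)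
  have h3 : ∑ i, ∑ j, S i j * (2 * A i j - 1) =
      2 * ∑ i, ∑ j, S i j * A i j - ∑ i, ∑ j, S i j := by
    simp only [mul_sum, ← sum_sub_distrib]
    exact sum_congr rfl fun i _ => sum_congr rfl fun j _ => by ring
  simp only [of_apply] at h2
  rw [h3] at h2
  have h4 : ∑ i, ∑ j, (1 - (2 * A i j - 1) ^ 2) =
      (Fintype.card V : ℝ) ^ 2 - ∑ i, ∑ j, (2 * A i j - 1) ^ 2 := by
    simp only [sum_sub_distrib, sum_const, card_univ, nsmul_eq_mul, mul_one]
    ring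
  rw [h1, h2, h4, htr]
  linear_combination (-2 * (Fintype.card V : ℝ)) * hn

omit [DecidableEq V] in
theorem sum_sq_nonneg₂ (f : V → V → ℝ) : 0 ≤ ∑ i, ∑ j, f i j ^ 2 :=
  sum_nonneg fun _ _ => sum_nonneg fun _ _ => sq_nonneg _

omit [DecidableEq V] in
theorem sum_one_sub_sq_nonneg (h0 : ∀ i j, 0 ≤ A i j) (h1 : ∀ i j, A i j ≤ 1) :
    0 ≤ ∑ i, ∑ j, (1 - (2 * A i j - 1) ^ 2) :=
  sum_nonneg fun i _ => sum_nonneg fun j _ => by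
    nlinarith [mul_nonneg (h0 i j) (sub_nonneg.2 (h1 i j))]

theorem trace_involution_mul_le [Nonempty V] (hT : Sᵀ = S) (hS : S * S = 1) (hA : Aᵀ = A)
    (h0 : ∀ i j, 0 ≤ A i j) (h1 : ∀ i j, A i j ≤ 1) :
    (S * A).trace ≤ Fintype.card V / 2 * (1 + √(Fintype.card V)) := by
  have hpos : 0 < √(Fintype.card V : ℝ) := Real.sqrt_pos.2 (Nat.cast_pos.2 Fintype.card_pos)
  have key := trace_mul_deficit hT hS hA
  have e1 : 0 ≤ √(Fintype.card V : ℝ) * ∑ i, (∑ j, S i j - 1) ^ 2 :=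
    mul_nonneg hpos.le (sum_nonneg fun _ _ => sq_nonneg _)
  have e2 := sum_sq_nonneg₂ fun i j => √(Fintype.card V) * S i j - (2 * A i j - 1)
  have e3 := sum_one_sub_sq_nonneg h0 h1
  refine le_of_mul_le_mul_left ?_ (by positivity : 0 < 4 * √(Fintype.card V : ℝ))
  linarith

theorem trace_involution_mul_eq [Nonempty V] (hT : Sᵀ = S) (hS : S * S = 1) (hA : Aᵀ = A)
    (h0 : ∀ i j, 0 ≤ A i j) (h1 : ∀ i j, A i j ≤ 1)
    (h : (S * A).trace = Fintype.card V / 2 * (1 + √(Fintype.card V))) :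
    (∀ i, ∑ j, S i j = 1) ∧ (∀ i j, √(Fintype.card V) * S i j = 2 * A i j - 1) ∧
      ∀ i j, A i j = 0 ∨ A i j = 1 := by
  have hpos : 0 < √(Fintype.card V : ℝ) := Real.sqrt_pos.2 (Nat.cast_pos.2 Fintype.card_pos)
  have key := trace_mul_deficit hT hS hA
  have e0 : 0 ≤ ∑ i, (∑ j, S i j - 1) ^ 2 := sum_nonneg fun _ _ => sq_nonneg _
  have e1 := mul_nonneg hpos.le e0
  have e2 := sum_sq_nonneg₂ fun i j => √(Fintype.card V) * S i j - (2 * A i j - 1)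
  have e3 := sum_one_sub_sq_nonneg h0 h1
  rw [h] at key
  have z1 : ∑ i, (∑ j, S i j - 1) ^ 2 = 0 :=
    (mul_eq_zero.1 (by linarith : √(Fintype.card V : ℝ) * ∑ i, (∑ j, S i j - 1) ^ 2 = 0)).resolve_left
      hpos.ne'
  have z2 : ∑ i, ∑ j, (√(Fintype.card V) * S i j - (2 * A i j - 1)) ^ 2 = 0 := by linarith
  have z3 : ∑ i, ∑ j, (1 - (2 * A i j - 1) ^ 2) = 0 := by linarith
  have hterm : ∀ i j, 0 ≤ 1 - (2 * A i j - 1) ^ 2 := fun i j => by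
    nlinarith [mul_nonneg (h0 i j) (sub_nonneg.2 (h1 i j))]
  refine ⟨fun i => ?_, fun i j => ?_, fun i j => ?_⟩
  · have := (sum_eq_zero_iff_of_nonneg fun _ _ => sq_nonneg _).1 z1 i (mem_univ i)
    exact sub_eq_zero.1 (pow_eq_zero_iff two_ne_zero |>.1 this)
  · have := (sum_eq_zero_iff_of_nonneg fun _ _ => sum_nonneg fun _ _ => sq_nonneg _).1 z2 i
      (mem_univ i)
    have := (sum_eq_zero_iff_of_nonneg fun _ _ => sq_nonneg _).1 this j (mem_univ j)
    exact sub_eq_zero.1 (pow_eq_zero_iff two_ne_zero |>.1 this)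
  · have := (sum_eq_zero_iff_of_nonneg fun i _ => sum_nonneg fun j _ => hterm i j).1 z3 i
      (mem_univ i)
    have := (sum_eq_zero_iff_of_nonneg fun j _ => hterm i j).1 this j (mem_univ j)
    -- 1 − (2a − 1)² = −4a(a − 1).
    have : A i j * (A i j - 1) = 0 := by linear_combination this / (-4)
    exact (mul_eq_zero.1 this).imp id sub_eq_zero.1

end MatrixEnergy

/-! ### Entries of the extended adjacency matrix -/

section Graph

variable {V : Type*} [Fintype V] (G : SimpleGraph V) [DecidableRel G.Adj]

/-- The largest value that the degrees allow for an entry of the extended adjacency matrix. -/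
noncomputable def entryBound : ℝ :=
  ((G.maxDegree : ℝ) / G.minDegree + (G.minDegree : ℝ) / G.maxDegree) / 2

variable {G}

theorem one_le_entryBound (hδ : G.minDegree ≠ 0) : 1 ≤ entryBound G := by
  have hm : 0 < (G.minDegree : ℝ) := by exact_mod_cast Nat.pos_of_ne_zero hδ
  have hM : 0 < (G.maxDegree : ℝ) := hm.trans_le (by exact_mod_cast G.minDegree_le_maxDegree)
  rw [entryBound, div_add_div _ _ hm.ne' hM.ne', div_div, le_div_iff₀ (by positivity)]
  nlinarith [sq_nonneg ((G.maxDegree : ℝ) - G.minDegree)]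

theorem extAdjMatrix_nonneg (i j : V) : 0 ≤ extAdjMatrix G i j := by
  rw [extAdjMatrix, of_apply]
  split_ifs <;> positivity

theorem extAdjMatrix_le_entryBound (hδ : G.minDegree ≠ 0) (i j : V) :
    extAdjMatrix G i j ≤ entryBound G := by
  rw [extAdjMatrix, of_apply]
  split_ifs with h
  · have hm : 0 < (G.minDegree : ℝ) := by exact_mod_cast Nat.pos_of_ne_zero hδ
    have hmi : (G.minDegree : ℝ) ≤ G.degree i := by exact_mod_cast G.minDegree_le_degree i
    have hmj : (G.minDegree : ℝ) ≤ G.degree j := by exact_mod_cast G.minDegree_le_degree j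
    have hMi : (G.degree i : ℝ) ≤ G.maxDegree := by exact_mod_cast G.degree_le_maxDegree i
    have hMj : (G.degree j : ℝ) ≤ G.maxDegree := by exact_mod_cast G.degree_le_maxDegree j
    have hi := hm.trans_le hmi
    have hj := hm.trans_le hmj
    have hM := hi.trans_le hMi
    -- The product of these two factors is, after clearing denominators, the difference of the two
    -- sides.
    have h1 : 0 ≤ (G.maxDegree : ℝ) * G.degree i - G.minDegree * G.degree j :=
      sub_nonneg.2 (by rw [mul_comm (G.minDegree : ℝ)]; exact mul_le_mul hMj hmi hm.le hM.le)
    have h2 : 0 ≤ (G.maxDegree : ℝ) * G.degree j - G.minDegree * G.degree i :=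
      sub_nonneg.2 (by rw [mul_comm (G.minDegree : ℝ)]; exact mul_le_mul hMi hmj hm.le hM.le)
    rw [entryBound]
    refine div_le_div_of_nonneg_right ?_ zero_le_two
    rw [div_add_div _ _ hj.ne' hi.ne', div_add_div _ _ hm.ne' hM.ne',
      div_le_div_iff₀ (by positivity) (by positivity)]
    nlinarith [mul_nonneg h1 h2]
  · exact zero_le_one.trans (one_le_entryBound hδ)

theorem extAdjMatrix_pos (hδ : G.minDegree ≠ 0) {i j : V} (h : G.Adj i j) :
    0 < extAdjMatrix G i j := by
  have hi : 0 < G.degree i := (Nat.pos_of_ne_zero hδ).trans_le (G.minDegree_le_degree i)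
  have hj : 0 < G.degree j := (Nat.pos_of_ne_zero hδ).trans_le (G.minDegree_le_degree j)
  rw [extAdjMatrix, of_apply, if_pos h]
  positivity

theorem nonempty_of_minDegree_ne_zero (hδ : G.minDegree ≠ 0) : Nonempty V := by
  by_contra h
  rw [not_nonempty_iff] at h
  -- `minDegree` is 0 by default on an empty vertex type.
  exact hδ G.minDegree_of_subsingleton

theorem extAdjMatrix_eq_adjMatrix {k : ℕ} (hk : k ≠ 0) (h : G.IsRegularOfDegree k) :
    extAdjMatrix G = G.adjMatrix ℝ := by
  have : (k : ℝ) ≠ 0 := Nat.cast_ne_zero.2 hk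
  ext i j
  simp only [extAdjMatrix, of_apply, SimpleGraph.adjMatrix_apply, h.degree_eq, div_self this]
  norm_num

theorem entryBound_eq_one {k : ℕ} (hδ : G.minDegree ≠ 0) (h : G.IsRegularOfDegree k) :
    entryBound G = 1 := by
  have := nonempty_of_minDegree_ne_zero hδ
  have hmin : G.minDegree = k := h.minDegree_eq
  have hmax : G.maxDegree = k := h.maxDegree_eq
  have : (k : ℝ) ≠ 0 := Nat.cast_ne_zero.2 (hmin ▸ hδ)
  rw [entryBound, hmin, hmax, div_self this]
  norm_num

/-! ### The sign matrix and strong regularity -/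

variable (G) in
/-- The `±1` matrix with entry `1` exactly at adjacent pairs. -/
noncomputable def signMatrix : Matrix V V ℝ := of fun i j => 2 * G.adjMatrix ℝ i j - 1

omit [Fintype V] in
theorem signMatrix_transpose : (signMatrix G)ᵀ = signMatrix G := by
  ext i j
  simp [signMatrix, G.adj_comm]

theorem sum_adjMatrix (i : V) : ∑ j, G.adjMatrix ℝ i j = G.degree i := by
  simp [← G.card_neighborFinset_eq_degree, G.neighborFinset_eq_filter]

theorem sum_signMatrix (i : V) :
    ∑ j, signMatrix G i j = 2 * G.degree i - Fintype.card V := by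
  simp only [signMatrix, of_apply, sum_sub_distrib, ← mul_sum, sum_adjMatrix]
  simp

/-- Expand (2A − J)²; the entries of A² count common neighbours. -/
theorem signMatrix_mul_self_apply (i j : V) :
    (signMatrix G * signMatrix G) i j =
      4 * (Fintype.card (G.commonNeighbors i j) : ℝ) - 2 * G.degree i - 2 * G.degree j
        + Fintype.card V := by
  have hc : ∑ u, G.adjMatrix ℝ i u * G.adjMatrix ℝ u j =
      (Fintype.card (G.commonNeighbors i j) : ℝ) := by
    rw [← Set.toFinset_card]
    simp only [SimpleGraph.adjMatrix_apply, mul_ite, mul_one, mul_zero, ← ite_and, sum_boole]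
    congr 2
    ext u
    simp [SimpleGraph.mem_commonNeighbors, G.adj_comm, and_comm]
  have hi : ∑ u, G.adjMatrix ℝ i u = G.degree i := sum_adjMatrix i
  have hj : ∑ u, G.adjMatrix ℝ u j = G.degree j := by
    rw [← sum_adjMatrix j]
    exact sum_congr rfl fun u _ => by simp [G.adj_comm]
  have : ∀ u, signMatrix G i u * signMatrix G u j =
      4 * (G.adjMatrix ℝ i u * G.adjMatrix ℝ u j) - 2 * G.adjMatrix ℝ i u
        - 2 * G.adjMatrix ℝ u j + 1 := fun u => by simp only [signMatrix, of_apply]; ring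
  simp only [Matrix.mul_apply, this, sum_add_distrib, sum_sub_distrib, ← mul_sum, hc, hi, hj]
  simp


variable [DecidableEq V]

/-- Row sums are 2d − n, which fixes the degree k = (n + √n)/2. An off-diagonal entry of the square
is then 4c − 4k + n, which vanishes exactly when c = n/4 + √n/2, whether or not the pair is
adjacent. -/
theorem isSRGWith_iff_signMatrix (hδ : G.minDegree ≠ 0) :
    (∃ k l m : ℕ, (k : ℝ) = (Fintype.card V : ℝ) / 2 + √(Fintype.card V) / 2 ∧
      (l : ℝ) = (Fintype.card V : ℝ) / 4 + √(Fintype.card V) / 2 ∧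
      (m : ℝ) = (Fintype.card V : ℝ) / 4 + √(Fintype.card V) / 2 ∧
      G.IsSRGWith (Fintype.card V) k l m) ↔
    (∀ i, ∑ j, signMatrix G i j = √(Fintype.card V)) ∧
      signMatrix G * signMatrix G = (Fintype.card V : ℝ) • (1 : Matrix V V ℝ) := by
  constructor
  · rintro ⟨k, l, m, hk, hl, hm, h⟩
    refine ⟨fun i => ?_, ?_⟩
    · rw [sum_signMatrix, h.regular.degree_eq, hk]
      ring
    · ext i j
      rw [signMatrix_mul_self_apply, h.regular.degree_eq, h.regular.degree_eq, Matrix.smul_apply,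
        smul_eq_mul]
      rcases eq_or_ne i j with rfl | hij
      · have : Fintype.card (G.commonNeighbors i i) = k := by
          rw [← h.regular.degree_eq i, ← G.card_neighborSet_eq_degree]
          exact Fintype.card_congr (Equiv.setCongr (Set.inter_self _))
        rw [this, one_apply_eq]
        ring
      · rw [one_apply_ne hij]
        by_cases hadj : G.Adj i j
        · rw [h.of_adj i j hadj, hl, hk]
          ring
        · rw [h.of_not_adj hij hadj, hm, hk]
          ring
  · rintro ⟨hrow, hsq⟩
    have hdeg : ∀ i, (G.degree i : ℝ) = (Fintype.card V : ℝ) / 2 + √(Fintype.card V) / 2 :=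
      fun i => by
        have := hrow i
        rw [sum_signMatrix] at this
        linear_combination this / 2
    have hcommon : ∀ i j, i ≠ j → (Fintype.card (G.commonNeighbors i j) : ℝ) =
        (Fintype.card V : ℝ) / 4 + √(Fintype.card V) / 2 := fun i j hij => by
      have := congrFun (congrFun hsq i) j
      rw [signMatrix_mul_self_apply, Matrix.smul_apply, one_apply_ne hij, smul_zero, hdeg, hdeg] at this
      linear_combination this / 4
    -- The parameters must be natural numbers; an actual edge supplies them as cardinalities.
    obtain ⟨v⟩ := nonempty_of_minDegree_ne_zero hδ
    obtain ⟨w, hvw⟩ := (G.degree_pos_iff_exists_adj v).1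
      ((Nat.pos_of_ne_zero hδ).trans_le (G.minDegree_le_degree v))
    have hl := hcommon v w hvw.ne
    refine ⟨G.degree v, Fintype.card (G.commonNeighbors v w),
      Fintype.card (G.commonNeighbors v w), hdeg v, hl, hl, rfl, fun i => ?_, fun i j hij => ?_,
      fun i j hij _ => ?_⟩
    · exact Nat.cast_injective ((hdeg i).trans (hdeg v).symm)
    · exact Nat.cast_injective ((hcommon i j hij.ne).trans hl.symm)
    · exact Nat.cast_injective ((hcommon i j hij).trans hl.symm)

/-! ### The energy bound and its equality case -/

omit [DecidableEq V] in
theorem extAdjMatrix_transpose : (extAdjMatrix G)ᵀ = extAdjMatrix G := by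
  rw [← conjTranspose_eq_transpose_of_trivial]
  exact extAdjMatrix_isHermitian G

theorem exists_extEnergy_eq (hδ : G.minDegree ≠ 0) : ∃ S : Matrix V V ℝ, Sᵀ = S ∧ S * S = 1 ∧
    extEnergy G = entryBound G * (S * ((entryBound G)⁻¹ • extAdjMatrix G)).trace := by
  obtain ⟨S, hT, hS, htr⟩ := exists_involution_trace_mul_eq (extAdjMatrix_isHermitian G)
  have hr : entryBound G ≠ 0 := (zero_lt_one.trans_le (one_le_entryBound hδ)).ne'
  refine ⟨S, hT, hS, ?_⟩
  rw [Matrix.mul_smul, trace_smul, smul_eq_mul, mul_inv_cancel_left₀ hr, htr, extEnergy]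

omit [DecidableEq V] in
theorem scaled_extAdjMatrix_nonneg (hδ : G.minDegree ≠ 0) (i j : V) :
    0 ≤ ((entryBound G)⁻¹ • extAdjMatrix G) i j :=
  mul_nonneg (inv_nonneg.2 (zero_le_one.trans (one_le_entryBound hδ))) (extAdjMatrix_nonneg i j)

omit [DecidableEq V] in
theorem scaled_extAdjMatrix_le_one (hδ : G.minDegree ≠ 0) (i j : V) :
    ((entryBound G)⁻¹ • extAdjMatrix G) i j ≤ 1 := by
  rw [Matrix.smul_apply, smul_eq_mul,
    inv_mul_le_iff₀ (zero_lt_one.trans_le (one_le_entryBound hδ)), mul_one]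
  exact extAdjMatrix_le_entryBound hδ i j

theorem extEnergy_le (hδ : G.minDegree ≠ 0) :
    extEnergy G ≤ entryBound G * (Fintype.card V / 2 * (1 + √(Fintype.card V))) := by
  have := nonempty_of_minDegree_ne_zero hδ
  obtain ⟨S, hT, hS, htr⟩ := exists_extEnergy_eq hδ
  rw [htr]
  refine mul_le_mul_of_nonneg_left ?_ (zero_le_one.trans (one_le_entryBound hδ))
  exact trace_involution_mul_le hT hS (by rw [transpose_smul, extAdjMatrix_transpose])
    (scaled_extAdjMatrix_nonneg hδ) (scaled_extAdjMatrix_le_one hδ)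

/-- Entries on edges are positive, so equality forces the scaled ones to be 1. The scaled matrix is
thus the adjacency matrix, with no regularity assumed beforehand. -/
theorem signMatrix_of_extEnergy_eq (hδ : G.minDegree ≠ 0)
    (h : extEnergy G = entryBound G * (Fintype.card V / 2 * (1 + √(Fintype.card V)))) :
    (∀ i, ∑ j, signMatrix G i j = √(Fintype.card V)) ∧
      signMatrix G * signMatrix G = (Fintype.card V : ℝ) • (1 : Matrix V V ℝ) := by
  have := nonempty_of_minDegree_ne_zero hδ
  have hr : 0 < entryBound G := zero_lt_one.trans_le (one_le_entryBound hδ)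
  obtain ⟨S, hT, hS, htr⟩ := exists_extEnergy_eq hδ
  obtain ⟨h1, h2, h3⟩ := trace_involution_mul_eq hT hS
    (by rw [transpose_smul, extAdjMatrix_transpose]) (scaled_extAdjMatrix_nonneg hδ)
    (scaled_extAdjMatrix_le_one hδ) (mul_left_cancel₀ hr.ne' (htr.symm.trans h))
  have hadj : (entryBound G)⁻¹ • extAdjMatrix G = G.adjMatrix ℝ := by
    ext i j
    by_cases hij : G.Adj i j
    · have hpos : 0 < ((entryBound G)⁻¹ • extAdjMatrix G) i j :=
        mul_pos (inv_pos.2 hr) (extAdjMatrix_pos hδ hij)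
      rw [(h3 i j).resolve_left hpos.ne', SimpleGraph.adjMatrix_apply, if_pos hij]
    · simp [extAdjMatrix, hij]
  have hsign : signMatrix G = √(Fintype.card V : ℝ) • S := by
    ext i j
    rw [Matrix.smul_apply, smul_eq_mul, h2, hadj, signMatrix, of_apply]
  refine ⟨fun i => ?_, ?_⟩
  · simp only [hsign, Matrix.smul_apply, smul_eq_mul, ← mul_sum, h1, mul_one]
  · rw [hsign, smul_mul_smul_comm, hS, Real.mul_self_sqrt (Nat.cast_nonneg _)]

/-- The involution B/√n makes every deficit term vanish; it need not be known to be the sign of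
A_ex, since any orthogonal matrix bounds the energy from below. -/
theorem extEnergy_eq_of_signMatrix {k : ℕ} (hδ : G.minDegree ≠ 0) (hreg : G.IsRegularOfDegree k)
    (hrow : ∀ i, ∑ j, signMatrix G i j = √(Fintype.card V))
    (hsq : signMatrix G * signMatrix G = (Fintype.card V : ℝ) • (1 : Matrix V V ℝ)) :
    extEnergy G = entryBound G * (Fintype.card V / 2 * (1 + √(Fintype.card V))) := by
  have := nonempty_of_minDegree_ne_zero hδ
  have hk : k ≠ 0 := fun hk => hδ (hreg.minDegree_eq.trans hk)
  have hpos : 0 < √(Fintype.card V : ℝ) := Real.sqrt_pos.2 (Nat.cast_pos.2 Fintype.card_pos)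
  have hn : √(Fintype.card V : ℝ) * √(Fintype.card V) = Fintype.card V :=
    Real.mul_self_sqrt (Nat.cast_nonneg _)
  refine (extEnergy_le hδ).antisymm ?_
  set S : Matrix V V ℝ := (√(Fintype.card V : ℝ))⁻¹ • signMatrix G with hSdef
  have hT : Sᵀ = S := by rw [hSdef, transpose_smul, signMatrix_transpose]
  have hS : S * S = 1 := by
    rw [hSdef, smul_mul_smul_comm, hsq, smul_smul, ← mul_inv, hn,
      inv_mul_cancel₀ (Nat.cast_ne_zero.2 Fintype.card_ne_zero), one_smul]
  have hU : S ∈ Matrix.unitaryGroup V ℝ := by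
    rw [mem_unitaryGroup_iff, star_eq_conjTranspose, conjTranspose_eq_transpose_of_trivial, hT, hS]
  have hle := trace_mul_le_sum_abs_eigenvalues (extAdjMatrix_isHermitian G) hU
  rw [entryBound_eq_one hδ hreg, one_mul]
  refine le_trans (le_of_eq ?_) hle
  have key := trace_mul_deficit hT hS (extAdjMatrix_transpose (G := G))
  have z1 : ∀ i, ∑ j, S i j = 1 := fun i => by
    simp only [hSdef, Matrix.smul_apply, smul_eq_mul, ← mul_sum, hrow, inv_mul_cancel₀ hpos.ne']
  have z2 : ∀ i j, √(Fintype.card V : ℝ) * S i j = 2 * extAdjMatrix G i j - 1 := fun i j => by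
    rw [hSdef, Matrix.smul_apply, smul_eq_mul, mul_inv_cancel_left₀ hpos.ne',
      extAdjMatrix_eq_adjMatrix hk hreg, signMatrix, of_apply]
  have z3 : ∀ i j, (2 * extAdjMatrix G i j - 1) ^ 2 = 1 := fun i j => by
    rw [extAdjMatrix_eq_adjMatrix hk hreg, SimpleGraph.adjMatrix_apply]
    split_ifs <;> norm_num
  simp only [z1, z2, z3, sub_self, ne_eq, OfNat.ofNat_ne_zero, not_false_eq_true, zero_pow,
    sum_const_zero, mul_zero, sub_zero] at key
  refine mul_left_cancel₀ (by positivity : 4 * √(Fintype.card V : ℝ) ≠ 0) ?_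
  rw [key]
  ring

theorem extEnergy_eq_iff (hδ : G.minDegree ≠ 0) :
    extEnergy G = entryBound G * (Fintype.card V / 2 * (1 + √(Fintype.card V))) ↔
    ∃ k l m : ℕ, (k : ℝ) = (Fintype.card V : ℝ) / 2 + √(Fintype.card V) / 2 ∧
      (l : ℝ) = (Fintype.card V : ℝ) / 4 + √(Fintype.card V) / 2 ∧
      (m : ℝ) = (Fintype.card V : ℝ) / 4 + √(Fintype.card V) / 2 ∧
      G.IsSRGWith (Fintype.card V) k l m := by
  refine ⟨fun h => (isSRGWith_iff_signMatrix hδ).2 (signMatrix_of_extEnergy_eq hδ h), fun h => ?_⟩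
  obtain ⟨hrow, hsq⟩ := (isSRGWith_iff_signMatrix hδ).1 h
  obtain ⟨k, l, m, -, -, -, hG⟩ := h
  exact extEnergy_eq_of_signMatrix hδ hG.regular hrow hsq

end Graph

end ExtendedEnergy

theorem mainTheorem7 {V : Type*} [Fintype V] [DecidableEq V] (G : SimpleGraph V)
    [DecidableRel G.Adj] (n : ℕ) (hn : Fintype.card V = n) (hδ : G.minDegree ≠ 0) :
    ExtendedEnergy.extEnergy G ≤
        (n : ℝ) / 4 * ((G.maxDegree : ℝ) / G.minDegree + (G.minDegree : ℝ) / G.maxDegree) *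
          (1 + Real.sqrt n) ∧
      (ExtendedEnergy.extEnergy G =
          (n : ℝ) / 4 * ((G.maxDegree : ℝ) / G.minDegree + (G.minDegree : ℝ) / G.maxDegree) *
            (1 + Real.sqrt n) ↔
        ∃ k l m : ℕ, (k : ℝ) = (n : ℝ) / 2 + Real.sqrt n / 2 ∧
          (l : ℝ) = (n : ℝ) / 4 + Real.sqrt n / 2 ∧
          (m : ℝ) = (n : ℝ) / 4 + Real.sqrt n / 2 ∧
          G.IsSRGWith n k l m) ∧
      (n : ℝ) / 4 * ((G.maxDegree : ℝ) / G.minDegree + (G.minDegree : ℝ) / G.maxDegree) *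
          (1 + Real.sqrt n) ≤
        (n : ℝ) / 8 * (1 + Real.sqrt n) *
          ((G.maxDegree : ℝ) / G.minDegree + (G.minDegree : ℝ) / G.maxDegree) ^ 2 := by
  subst hn
  have hbound : (Fintype.card V : ℝ) / 4 *
      ((G.maxDegree : ℝ) / G.minDegree + (G.minDegree : ℝ) / G.maxDegree) *
        (1 + √(Fintype.card V)) =
      ExtendedEnergy.entryBound G * (Fintype.card V / 2 * (1 + √(Fintype.card V))) := by
    rw [ExtendedEnergy.entryBound]
    ring
  -- The older bound is the new one times `entryBound`, which is at least 1.
  have hbound' : (Fintype.card V : ℝ) / 8 * (1 + √(Fintype.card V)) *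
      ((G.maxDegree : ℝ) / G.minDegree + (G.minDegree : ℝ) / G.maxDegree) ^ 2 =
      ExtendedEnergy.entryBound G *
        (ExtendedEnergy.entryBound G * (Fintype.card V / 2 * (1 + √(Fintype.card V)))) := by
    rw [ExtendedEnergy.entryBound]
    ring
  have hr := ExtendedEnergy.one_le_entryBound hδ
  rw [hbound, hbound']
  exact ⟨ExtendedEnergy.extEnergy_le hδ, ExtendedEnergy.extEnergy_eq_iff hδ,
    le_mul_of_one_le_left (by positivity) hr⟩
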